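/- For complex numbers $a, q$ with $|q|<1$ write $(a;q)_n=\prod_{k=0}^{n-1}(1-aq^k)$ for $n\ge 0$ and $(a;q)_\infty=\prod_{k=0}^{\infty}(1-aq^k)$. Let $q\in\mathbb{C}$ with $|q|<1$. Then $$\sum_{n=0}^{\infty}\frac{(-1)^n\,(q;q^2)_n\,q^{n^2+2n}}{(q^4;q^4)_n}=\frac{(q^6;q^6)_\infty}{(-q^3;q^6)_\infty\,(q^4;q^4)_\infty},$$ where the series converges absolutely, the three infinite products converge, and none of the denominators $(q^4;q^4)_n$ ($n\ge 0$), $(-q^3;q^6)_\infty$, $(q^4;q^4)_\infty$ vanishes. -/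

import Mathlib

/-- The finite `q`-shifted factorial `(a; q)_n = ∏_{k=0}^{n-1} (1 - a q^k)`. -/
noncomputable def qPoch (a q : ℂ) (n : ℕ) : ℂ :=
  ∏ k ∈ Finset.range n, (1 - a * q ^ k)

/-- The infinite `q`-shifted factorial `(a; q)_∞ = ∏_{k≥0} (1 - a q^k)`. -/
noncomputable def qPochInf (a q : ℂ) : ℂ :=
  ∏' k : ℕ, (1 - a * q ^ k)

open Filter Topology

/-! This is a Bailey pair argument in base p = q². The reciprocal 1/(p²;p²)_n is expanded over r ≤ n
by `sum_bailey_pair`, and the resulting double series, which is absolutely convergent, is summed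
first over m = n - r. For fixed r the inner sum is a ₁φ₁ that Cauchy's formula (`hasSum_phiTerm`)
evaluates. What remains is a constant times a theta series of base q⁶, which the Jacobi triple
product (`tsum_jacobi`) turns into a product; splitting the products by residue class gives the
stated quotient. Both finite identities and the ₁φ₁ recurrence are proved by telescoping with an
explicit certificate G. -/

/-! ### Shifted factorials: convergence, nonvanishing, uniform bounds. -/

theorem qPoch_zero (a q : ℂ) : qPoch a q 0 = 1 := by simp [qPoch]

theorem qPoch_succ (a q : ℂ) (n : ℕ) :
    qPoch a q (n + 1) = qPoch a q n * (1 - a * q ^ n) := by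
  simp [qPoch, Finset.prod_range_succ]

theorem qPoch_add (a q : ℂ) (n m : ℕ) :
    qPoch a q (n + m) = qPoch a q n * qPoch (a * q ^ n) q m := by
  simp only [qPoch, Finset.prod_range_add]
  congr 1
  refine Finset.prod_congr rfl fun k _ => ?_
  ring

theorem qPoch_ne_zero {a q : ℂ} (h : ∀ k, a * q ^ k ≠ 1) (n : ℕ) : qPoch a q n ≠ 0 :=
  Finset.prod_ne_zero_iff.2 fun k _ => sub_ne_zero.2 (h k).symm

theorem mul_pow_ne_one {a q : ℂ} (ha : ‖a‖ < 1) (hq : ‖q‖ < 1) (k : ℕ) : a * q ^ k ≠ 1 := by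
  intro h
  have h1 : ‖a * q ^ k‖ = 1 := by rw [h, norm_one]
  rw [norm_mul, norm_pow] at h1
  have h2 : ‖q‖ ^ k ≤ 1 := pow_le_one₀ (norm_nonneg _) hq.le
  nlinarith [norm_nonneg a]

theorem summable_norm_mul_pow (a : ℂ) {q : ℂ} (hq : ‖q‖ < 1) :
    Summable fun k : ℕ => ‖-(a * q ^ k)‖ := by
  simp only [norm_neg, norm_mul, norm_pow]
  exact (summable_geometric_of_lt_one (norm_nonneg _) hq).mul_left _

theorem multipliable_one_sub_mul_pow (a : ℂ) {q : ℂ} (hq : ‖q‖ < 1) :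
    Multipliable fun k : ℕ => 1 - a * q ^ k := by
  simpa [sub_eq_add_neg] using multipliable_one_add_of_summable (summable_norm_mul_pow a hq)

theorem tendsto_qPoch (a : ℂ) {q : ℂ} (hq : ‖q‖ < 1) :
    Tendsto (qPoch a q) atTop (𝓝 (qPochInf a q)) :=
  (multipliable_one_sub_mul_pow a hq).hasProd.tendsto_prod_nat

theorem qPochInf_ne_zero {a q : ℂ} (hq : ‖q‖ < 1) (h : ∀ k, a * q ^ k ≠ 1) :
    qPochInf a q ≠ 0 := by
  have := tprod_one_add_ne_zero_of_summable (f := fun k : ℕ => -(a * q ^ k))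
    (fun k => by simpa [← sub_eq_add_neg, sub_eq_zero] using (h k).symm)
    (summable_norm_mul_pow a hq)
  simpa [qPochInf, sub_eq_add_neg] using this

theorem qPochInf_eq_mul (a : ℂ) {q : ℂ} (hq : ‖q‖ < 1) (n : ℕ) :
    qPochInf a q = qPoch a q n * qPochInf (a * q ^ n) q := by
  refine tendsto_nhds_unique ((tendsto_add_atTop_iff_nat n).2 (tendsto_qPoch a hq)) ?_
  simp only [add_comm _ n, qPoch_add]
  exact (tendsto_qPoch _ hq).const_mul _

theorem exists_norm_le_of_tendsto {f : ℕ → ℂ} {l : ℂ} (h : Tendsto f atTop (𝓝 l)) :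
    ∃ C, 0 ≤ C ∧ ∀ n, ‖f n‖ ≤ C := by
  obtain ⟨C, hC⟩ := (Metric.isBounded_range_of_tendsto f h).exists_norm_le
  exact ⟨C, (norm_nonneg _).trans (hC _ ⟨0, rfl⟩), fun n => hC _ ⟨n, rfl⟩⟩

theorem exists_norm_qPoch_le (a : ℂ) {q : ℂ} (hq : ‖q‖ < 1) :
    ∃ C, 0 ≤ C ∧ ∀ n, ‖qPoch a q n‖ ≤ C :=
  exists_norm_le_of_tendsto (tendsto_qPoch a hq)

/-- The inverses converge because the limit product is nonzero. This supplies the constants for all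
dominated convergence below. -/
theorem exists_norm_qPoch_inv_le {a q : ℂ} (hq : ‖q‖ < 1) (h : ∀ k, a * q ^ k ≠ 1) :
    ∃ C, 0 ≤ C ∧ ∀ n, ‖(qPoch a q n)⁻¹‖ ≤ C :=
  exists_norm_le_of_tendsto ((tendsto_qPoch a hq).inv₀ (qPochInf_ne_zero hq h))

/-! ### Finite identities by telescoping. -/

theorem choose_succ_two (n : ℕ) : (n + 1).choose 2 = n.choose 2 + n := by
  rw [Nat.choose_succ_succ' n 1, Nat.choose_one_right, add_comm]

/-- A Bailey pair: the expansion of `1 / (p²; p²)_n`. -/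
theorem sum_bailey_pair {p : ℂ} (hp : ‖p‖ < 1) (n : ℕ) :
    ∑ r ∈ Finset.range (n + 1), (-1) ^ r * p ^ (r ^ 2) * (1 - p ^ (2 * r + 1)) /
      (qPoch p p (n - r) * qPoch p p (n + r + 1)) = (qPoch (p ^ 2) (p ^ 2) n)⁻¹ := by
  have hne : ∀ k, p * p ^ k ≠ 1 := mul_pow_ne_one hp hp
  have h0 := qPoch_ne_zero hne
  have hp2 : ‖p ^ 2‖ < 1 := by
    rw [norm_pow]; exact pow_lt_one₀ (norm_nonneg _) hp two_ne_zero
  have hne2 : ∀ k, p ^ 2 * (p ^ 2) ^ k ≠ 1 := mul_pow_ne_one hp2 hp2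
  induction n with
  | zero =>
    have := hne 0
    simp only [pow_zero, mul_one] at this
    have h1 : 1 - p ≠ 0 := sub_ne_zero.2 this.symm
    simp [qPoch, h1]
  | succ n ih =>
    have h2 : 1 - p ^ 2 * (p ^ 2) ^ n ≠ 0 := sub_ne_zero.2 (hne2 n).symm
    let f : ℕ → ℕ → ℂ := fun n r => (-1) ^ r * p ^ (r ^ 2) * (1 - p ^ (2 * r + 1)) /
      (qPoch p p (n - r) * qPoch p p (n + r + 1))
    -- Certificate in r for the recurrence in n; the factor 1 - p^(2r) makes it vanish at r = 0.
    let G : ℕ → ℂ := fun r => -(-1) ^ r * p ^ (n + 1 - r) * p ^ (r ^ 2) * (1 - p ^ (2 * r)) /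
      (qPoch p p (n + 1 - r) * qPoch p p (n + r + 1))
    have key : ∀ r ∈ Finset.range (n + 1),
        (1 - p ^ 2 * (p ^ 2) ^ n) * f (n + 1) r - f n r = G (r + 1) - G r := by
      intro r hr
      obtain ⟨d, rfl⟩ := Nat.exists_eq_add_of_le (Nat.lt_succ_iff.1 (Finset.mem_range.1 hr))
      have e1 : r + d - r = d := by omega
      have e2 : r + d + 1 - r = d + 1 := by omega
      have e3 : r + d + 1 - (r + 1) = d := by omega
      have e4 : r + d + 1 + r + 1 = (r + d + r + 1) + 1 := by omega
      have e5 : r + d + (r + 1) + 1 = (r + d + r + 1) + 1 := by omega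
      have h3 : 1 - p * p ^ d ≠ 0 := sub_ne_zero.2 (hne _).symm
      have h4 : 1 - p * p ^ (r + d + r + 1) ≠ 0 := sub_ne_zero.2 (hne _).symm
      have h5 := h0 d
      have h6 := h0 (r + d + r + 1)
      simp only [f, G, e1, e2, e3, e4, e5, qPoch_succ p p d, qPoch_succ p p (r + d + r + 1)]
      generalize qPoch p p d = X at *
      generalize qPoch p p (r + d + r + 1) = Y at *
      field_simp
      ring
    have hsum := Finset.sum_congr rfl key
    rw [Finset.sum_range_sub, Finset.sum_sub_distrib, ← Finset.mul_sum] at hsum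
    rw [qPoch_succ, mul_inv, ← ih, Finset.sum_range_succ]
    change ∑ r ∈ Finset.range (n + 1), f (n + 1) r + f (n + 1) (n + 1) =
      (∑ r ∈ Finset.range (n + 1), f n r) * _
    rw [eq_mul_inv_iff_mul_eq₀ h2]
    have hG0 : G 0 = 0 := by simp [G]
    -- The top term r = n + 1 has no counterpart at level n (there n - r would truncate), so it is
    -- cancelled against G separately.
    have hb : (1 - p ^ 2 * (p ^ 2) ^ n) * f (n + 1) (n + 1) + G (n + 1) = 0 := by
      have e4 : n + 1 + (n + 1) + 1 = (n + (n + 1) + 1) + 1 := by omega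
      have h4 : 1 - p * p ^ (n + (n + 1) + 1) ≠ 0 := sub_ne_zero.2 (hne _).symm
      have h6 := h0 (n + (n + 1) + 1)
      simp only [f, G, Nat.sub_self, e4, qPoch_succ p p (n + (n + 1) + 1), qPoch_zero]
      generalize qPoch p p (n + (n + 1) + 1) = Y at *
      field_simp
      ring
    linear_combination hsum + hb - hG0

/-- The finite form of the Jacobi triple product identity, with the two halves of the
bilateral sum folded together. -/
theorem sum_jacobi_finite {P a b : ℂ} (hP : ‖P‖ < 1) (hab : a * b = P) (N : ℕ) :
    ∑ r ∈ Finset.range (N + 1), (P ^ (r.choose 2) * b ^ r + P ^ ((r + 1).choose 2) * a ^ (r + 1)) /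
      (qPoch P P (N - r) * qPoch P P (N + r + 1)) =
    qPoch (-a) P (N + 1) * qPoch (-b) P N / qPoch P P (2 * N + 1) := by
  have hne : ∀ k, P * P ^ k ≠ 1 := mul_pow_ne_one hP hP
  have h0 := qPoch_ne_zero hne
  induction N with
  | zero => simp [qPoch]
  | succ N ih =>
    let f : ℕ → ℕ → ℂ := fun n r =>
      (P ^ (r.choose 2) * b ^ r + P ^ ((r + 1).choose 2) * a ^ (r + 1)) /
        (qPoch P P (n - r) * qPoch P P (n + r + 1))
    let w : ℂ := P ^ (N + 1)
    let G : ℕ → ℂ := fun r => P ^ (r.choose 2) *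
      (b ^ r * (-P ^ (N + 1 - r) * (1 + a * w) + w * (a + w)) -
        a ^ r * w * (-P ^ r * (1 + a * w) + (a + w))) /
      (qPoch P P (N + 1 - r) * qPoch P P (N + r + 1))
    -- The multipliers are the factors that the denominator and the numerator of the right side gain
    -- from N to N + 1.
    have key : ∀ r ∈ Finset.range (N + 1),
        (1 - P ^ (2 * N + 2)) * (1 - P ^ (2 * N + 3)) * f (N + 1) r -
          (1 + a * w) * (1 + b * P ^ N) * f N r = G (r + 1) - G r := by
      intro r hr
      obtain ⟨d, rfl⟩ := Nat.exists_eq_add_of_le (Nat.lt_succ_iff.1 (Finset.mem_range.1 hr))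
      have e1 : r + d - r = d := by omega
      have e2 : r + d + 1 - r = d + 1 := by omega
      have e3 : r + d + 1 - (r + 1) = d := by omega
      have e4 : r + d + 1 + r + 1 = (r + d + r + 1) + 1 := by omega
      have e5 : r + d + (r + 1) + 1 = (r + d + r + 1) + 1 := by omega
      have h3 : 1 - P * P ^ d ≠ 0 := sub_ne_zero.2 (hne _).symm
      have h4 : 1 - P * P ^ (r + d + r + 1) ≠ 0 := sub_ne_zero.2 (hne _).symm
      have h5 := h0 d
      have h6 := h0 (r + d + r + 1)
      simp only [f, G, w, e1, e2, e3, e4, e5, qPoch_succ P P d, qPoch_succ P P (r + d + r + 1),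
        choose_succ_two]
      generalize qPoch P P d = X at *
      generalize qPoch P P (r + d + r + 1) = Y at *
      field_simp
      subst hab
      ring
    have hsum := Finset.sum_congr rfl key
    rw [Finset.sum_range_sub, Finset.sum_sub_distrib, ← Finset.mul_sum, ← Finset.mul_sum] at hsum
    have h7 : 1 - P ^ (2 * N + 2) ≠ 0 := by
      have := hne (2 * N + 1); rw [← pow_succ'] at this; exact sub_ne_zero.2 this.symm
    have h8 : 1 - P ^ (2 * N + 3) ≠ 0 := by
      have := hne (2 * N + 2); rw [← pow_succ'] at this; exact sub_ne_zero.2 this.symm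
    have hG0 : G 0 = 0 := by simp [G, w]; ring_nf; simp
    have hb : (1 - P ^ (2 * N + 2)) * (1 - P ^ (2 * N + 3)) * f (N + 1) (N + 1) + G (N + 1) = 0 := by
      have e4 : N + 1 + (N + 1) + 1 = (N + (N + 1) + 1) + 1 := by omega
      have e6 : 1 - P * P ^ (N + (N + 1) + 1) = 1 - P ^ (2 * N + 3) := by ring
      have h6 := h0 (N + (N + 1) + 1)
      simp only [f, G, w, Nat.sub_self, e4, qPoch_succ P P (N + (N + 1) + 1), qPoch_zero, e6,
        choose_succ_two]
      generalize qPoch P P (N + (N + 1) + 1) = Y at *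
      field_simp
      ring
    have ih' : ∑ r ∈ Finset.range (N + 1), f N r =
      qPoch (-a) P (N + 1) * qPoch (-b) P N / qPoch P P (2 * N + 1) := ih
    change ∑ r ∈ Finset.range (N + 1 + 1), f (N + 1) r = _
    rw [Finset.sum_range_succ]
    have e7 : 2 * (N + 1) + 1 = 2 * N + 1 + 1 + 1 := by ring
    have e8 : 1 - P * P ^ (2 * N + 1) = 1 - P ^ (2 * N + 2) := by ring
    have e9 : 1 - P * P ^ (2 * N + 1 + 1) = 1 - P ^ (2 * N + 3) := by ring
    rw [e7, qPoch_succ P P (2 * N + 1 + 1), qPoch_succ P P (2 * N + 1), e8, e9,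
      qPoch_succ (-a) P (N + 1), qPoch_succ (-b) P N, eq_div_iff (by
        exact mul_ne_zero (mul_ne_zero (h0 _) h7) h8)]
    rw [ih'] at hsum
    have h9 := h0 (2 * N + 1)
    have hs2 : (1 - P ^ (2 * N + 2)) * (1 - P ^ (2 * N + 3)) *
        (∑ r ∈ Finset.range (N + 1), f (N + 1) r + f (N + 1) (N + 1)) =
        (1 + a * w) * (1 + b * P ^ N) *
          (qPoch (-a) P (N + 1) * qPoch (-b) P N / qPoch P P (2 * N + 1)) := by
      linear_combination hsum + hb - hG0
    field_simp at hs2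
    simp only [w] at hs2
    linear_combination hs2

/-! ### Jacobi triple product as N → ∞. -/

theorem norm_pow_mul_pow_le {P b : ℂ} (hP : ‖P‖ < 1) (m r : ℕ) : ‖P ^ m * b ^ r‖ ≤ ‖b‖ ^ r := by
  rw [norm_mul, norm_pow, norm_pow]
  exact mul_le_of_le_one_left (by positivity) (pow_le_one₀ (norm_nonneg _) hP.le)

/-- The Jacobi triple product identity, folded. -/
theorem tsum_jacobi {P a b : ℂ} (hP : ‖P‖ < 1) (ha : ‖a‖ < 1) (hb : ‖b‖ < 1) (hab : a * b = P) :
    ∑' r : ℕ, (P ^ (r.choose 2) * b ^ r + P ^ ((r + 1).choose 2) * a ^ (r + 1)) =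
      qPochInf (-a) P * qPochInf (-b) P * qPochInf P P := by
  have hne : ∀ k, P * P ^ k ≠ 1 := mul_pow_ne_one hP hP
  have hinf := qPochInf_ne_zero hP hne
  obtain ⟨C, hC0, hC⟩ := exists_norm_qPoch_inv_le hP hne
  let u : ℕ → ℂ := fun r => P ^ (r.choose 2) * b ^ r + P ^ ((r + 1).choose 2) * a ^ (r + 1)
  -- The explicit cutoff is needed: for r > N the truncated N - r is 0 and would leave spurious
  -- terms.
  let v : ℕ → ℕ → ℂ := fun N r => if r < N + 1 then
    u r / (qPoch P P (N - r) * qPoch P P (N + r + 1)) else 0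
  have hu : ∀ r, ‖u r‖ ≤ ‖b‖ ^ r + ‖a‖ ^ (r + 1) := fun r =>
    (norm_add_le _ _).trans (add_le_add (norm_pow_mul_pow_le hP _ _) (norm_pow_mul_pow_le hP _ _))
  have hbound : Summable fun r : ℕ => (‖b‖ ^ r + ‖a‖ ^ (r + 1)) * (C * C) := by
    refine Summable.mul_right _ (Summable.add ?_ ?_)
    · exact summable_geometric_of_lt_one (norm_nonneg _) hb
    · exact (summable_nat_add_iff 1).2 (summable_geometric_of_lt_one (norm_nonneg _) ha)
  have hlim := tendsto_tsum_of_dominated_convergence (𝓕 := atTop) (f := v)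
    (g := fun r => u r / (qPochInf P P * qPochInf P P)) hbound
    (fun r => by
      have h1 : Tendsto (fun N => u r / (qPoch P P (N - r) * qPoch P P (N + r + 1))) atTop
          (𝓝 (u r / (qPochInf P P * qPochInf P P))) := by
        refine Tendsto.div tendsto_const_nhds (Tendsto.mul ?_ ?_) (mul_ne_zero hinf hinf)
        · exact (tendsto_qPoch P hP).comp (tendsto_sub_atTop_nat r)
        · exact (tendsto_qPoch P hP).comp (tendsto_add_atTop_nat (r + 1))
      refine h1.congr' ?_
      filter_upwards [eventually_ge_atTop r] with N hN
      simp only [v, if_pos (Nat.lt_succ_of_le hN)])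
    (Eventually.of_forall fun N r => by
      by_cases h : r < N + 1
      · simp only [v, h, if_true, div_eq_mul_inv, mul_inv, norm_mul]
        gcongr
        · exact hu r
        · exact hC _
        · exact hC _
      · simp only [v, h, if_false, norm_zero]
        positivity)
  have hfin : ∀ N, ∑' r, v N r =
      qPoch (-a) P (N + 1) * qPoch (-b) P N / qPoch P P (2 * N + 1) := by
    intro N
    rw [← sum_jacobi_finite hP hab N, tsum_eq_sum (s := Finset.range (N + 1))]
    · refine Finset.sum_congr rfl fun r hr => ?_
      simp only [v, u, if_pos (Finset.mem_range.1 hr)]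
    · intro r hr
      simp only [v, if_neg (fun h => hr (Finset.mem_range.2 h))]
  simp only [hfin] at hlim
  have hlim2 : Tendsto (fun N => qPoch (-a) P (N + 1) * qPoch (-b) P N / qPoch P P (2 * N + 1))
      atTop (𝓝 (qPochInf (-a) P * qPochInf (-b) P / qPochInf P P)) := by
    refine Tendsto.div (Tendsto.mul ?_ (tendsto_qPoch _ hP)) ?_ hinf
    · exact (tendsto_qPoch _ hP).comp (tendsto_add_atTop_nat 1)
    · exact (tendsto_qPoch P hP).comp (tendsto_atTop_mono (fun n => by simp only [id]; omega) tendsto_id)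
  have h := tendsto_nhds_unique hlim hlim2
  rw [tsum_div_const] at h
  change ∑' r, u r = _
  field_simp at h
  linear_combination h

/-! ### Cauchy's ₁φ₁ sum. -/

/-- The summand of the `₁φ₁` series with lower parameter `A * B` and argument `B`. -/
noncomputable def phiTerm (p A B : ℂ) (m : ℕ) : ℂ :=
  qPoch A p m * (-1) ^ m * p ^ (m.choose 2) * B ^ m / (qPoch p p m * qPoch (A * B) p m)

theorem norm_phiTerm_le {p A : ℂ} (hp : ‖p‖ < 1) (B : ℂ) {C₁ C₂ C₃ : ℝ} {m : ℕ}
    (hC₁ : 0 ≤ C₁) (hC₂ : 0 ≤ C₂)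
    (h₁ : ‖qPoch A p m‖ ≤ C₁) (h₂ : ‖(qPoch p p m)⁻¹‖ ≤ C₂)
    (h₃ : ‖(qPoch (A * B) p m)⁻¹‖ ≤ C₃) :
    ‖phiTerm p A B m‖ ≤ C₁ * C₂ * C₃ * ‖B‖ ^ m := by
  have h : ‖p‖ ^ (m.choose 2) ≤ 1 := pow_le_one₀ (norm_nonneg _) hp.le
  have : ‖phiTerm p A B m‖ = ‖qPoch A p m‖ * ‖p‖ ^ (m.choose 2) * ‖B‖ ^ m *
      (‖(qPoch p p m)⁻¹‖ * ‖(qPoch (A * B) p m)⁻¹‖) := by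
    simp only [phiTerm, div_eq_mul_inv, mul_inv, norm_mul, norm_pow, norm_neg, norm_one, one_pow,
      mul_one]
  rw [this]
  calc _ ≤ C₁ * 1 * ‖B‖ ^ m * (C₂ * C₃) := by gcongr
    _ = _ := by ring

theorem summable_phiTerm {p A B : ℂ} (hp : ‖p‖ < 1) (hB : ‖B‖ < 1)
    (h : ∀ k, A * B * p ^ k ≠ 1) : Summable (phiTerm p A B) := by
  obtain ⟨C₁, hC₁, h₁⟩ := exists_norm_qPoch_le A hp
  obtain ⟨C₂, hC₂, h₂⟩ := exists_norm_qPoch_inv_le hp (mul_pow_ne_one hp hp)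
  obtain ⟨C₃, hC₃, h₃⟩ := exists_norm_qPoch_inv_le hp h
  exact Summable.of_norm_bounded
    ((summable_geometric_of_lt_one (norm_nonneg _) hB).mul_left (C₁ * C₂ * C₃))
    fun m => norm_phiTerm_le hp B hC₁ hC₂ (h₁ m) (h₂ m) (h₃ m)

theorem norm_mul_pow_lt_one {p B : ℂ} (hp : ‖p‖ < 1) (hB : ‖B‖ < 1) (k : ℕ) :
    ‖B * p ^ k‖ < 1 := by
  rw [norm_mul, norm_pow]
  exact mul_lt_one_of_nonneg_of_lt_one_left (norm_nonneg _) hB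
    (pow_le_one₀ (norm_nonneg _) hp.le)

/-- The termwise difference telescopes, with a certificate that is 0 at m = 0 and tends to 0.
Iteration drives B to 0, where the series reduces to 1. -/
theorem mul_tsum_phiTerm {p A B : ℂ} (hp : ‖p‖ < 1) (hB : ‖B‖ < 1)
    (h : ∀ k, A * B * p ^ k ≠ 1) :
    (1 - A * B) * ∑' m, phiTerm p A B m = (1 - B) * ∑' m, phiTerm p A (B * p) m := by
  have h' : ∀ k, A * (B * p) * p ^ k ≠ 1 := fun k => by
    have := h (k + 1); rw [pow_succ'] at this; simpa [mul_assoc] using this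
  have hBp : ‖B * p‖ < 1 := by simpa using norm_mul_pow_lt_one hp hB 1
  have hs := summable_phiTerm hp hB h
  have hs' := summable_phiTerm hp hBp h'
  let G : ℕ → ℂ := fun m => -(1 - A * B) * (1 - p ^ m) * phiTerm p A B m
  have key : ∀ m, (1 - A * B) * phiTerm p A B m - (1 - B) * phiTerm p A (B * p) m =
      G (m + 1) - G m := by
    intro m
    have hAB : 1 - A * B ≠ 0 := sub_ne_zero.2 (by simpa using (h 0).symm)
    have h1 : 1 - A * B * p ^ m ≠ 0 := sub_ne_zero.2 (h m).symm
    have h2 : 1 - p * p ^ m ≠ 0 := sub_ne_zero.2 (mul_pow_ne_one hp hp m).symm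
    have h3 := qPoch_ne_zero (mul_pow_ne_one hp hp) m
    have h4 := qPoch_ne_zero h m
    have h5 : qPoch (A * (B * p)) p m = qPoch (A * B) p m * (1 - A * B * p ^ m) / (1 - A * B) := by
      rw [eq_div_iff hAB, ← qPoch_succ, add_comm, qPoch_add]
      have e : A * B * p ^ 1 = A * (B * p) := by ring
      rw [e, qPoch_succ, qPoch_zero]
      ring
    simp only [G, phiTerm, qPoch_succ, choose_succ_two, h5]
    generalize qPoch p p m = X at *
    generalize qPoch (A * B) p m = Y at *
    generalize qPoch A p m = Z at *
    field_simp
    ring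
  have hG : Tendsto G atTop (𝓝 0) := by
    have h1 : Tendsto (fun m => p ^ m) atTop (𝓝 0) := tendsto_pow_atTop_nhds_zero_of_norm_lt_one hp
    simpa [G] using ((h1.const_sub 1).const_mul (-(1 - A * B))).mul hs.tendsto_atTop_zero
  have hsum := ((hs.mul_left (1 - A * B)).sub (hs'.mul_left (1 - B))).hasSum.tendsto_sum_nat
  have hG2 : Tendsto (fun n => ∑ m ∈ Finset.range n, (G (m + 1) - G m)) atTop (𝓝 0) := by
    simp only [Finset.sum_range_sub]
    simpa [G] using hG
  simp only [key] at hsum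
  have := tendsto_nhds_unique hsum hG2
  simp only [← key] at this
  rw [(hs.mul_left (1 - A * B)).tsum_sub (hs'.mul_left (1 - B)), tsum_mul_left, tsum_mul_left] at this
  exact sub_eq_zero.1 this

/-- Cauchy's summation of the `₁φ₁` series. -/
theorem hasSum_phiTerm {p A B : ℂ} (hp : ‖p‖ < 1) (hB : ‖B‖ < 1)
    (h : ∀ k, A * B * p ^ k ≠ 1) :
    HasSum (phiTerm p A B) (qPochInf B p / qPochInf (A * B) p) := by
  have hshift : ∀ N k, A * (B * p ^ N) * p ^ k ≠ 1 := fun N k => by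
    have := h (N + k); rw [pow_add] at this; simpa [mul_assoc] using this
  have hiter : ∀ N, qPoch (A * B) p N * ∑' m, phiTerm p A B m =
      qPoch B p N * ∑' m, phiTerm p A (B * p ^ N) m := by
    intro N
    induction N with
    | zero => simp [qPoch]
    | succ N ih =>
      have := mul_tsum_phiTerm hp (norm_mul_pow_lt_one hp hB N) (hshift N)
      rw [mul_assoc B, ← pow_succ] at this
      rw [qPoch_succ, qPoch_succ]
      linear_combination (1 - A * B * p ^ N) * ih + qPoch B p N * this
  obtain ⟨C₁, hC₁, h₁⟩ := exists_norm_qPoch_le A hp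
  obtain ⟨C₂, hC₂, h₂⟩ := exists_norm_qPoch_inv_le hp (mul_pow_ne_one hp hp)
  obtain ⟨C₃, hC₃, h₃⟩ := exists_norm_qPoch_inv_le hp h
  obtain ⟨C₄, hC₄, h₄⟩ := exists_norm_qPoch_le (A * B) hp
  have hpow : Tendsto (fun N => p ^ N) atTop (𝓝 0) :=
    tendsto_pow_atTop_nhds_zero_of_norm_lt_one hp
  have hBpow : Tendsto (fun N => B * p ^ N) atTop (𝓝 0) := by simpa using hpow.const_mul B
  have hlim := tendsto_tsum_of_dominated_convergence (𝓕 := atTop)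
    (f := fun N m => phiTerm p A (B * p ^ N) m)
    (g := fun m => phiTerm p A 0 m)
    ((summable_geometric_of_lt_one (norm_nonneg _) hB).mul_left (C₁ * C₂ * (C₄ * C₃)))
    (fun m => by
      have hq : Tendsto (fun N => qPoch (A * (B * p ^ N)) p m) atTop (𝓝 (qPoch (A * 0) p m)) := by
        simp only [qPoch]
        exact tendsto_finsetProd _ fun k _ =>
          ((hBpow.const_mul A).mul_const (p ^ k)).const_sub 1
      simp only [phiTerm]
      refine Tendsto.div ((hBpow.pow m).const_mul _) (hq.const_mul _) ?_
      refine mul_ne_zero (qPoch_ne_zero (mul_pow_ne_one hp hp) m) (qPoch_ne_zero (by simp) m))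
    (Eventually.of_forall fun N m => by
      -- A bound uniform in N: the shifted factorial is a quotient of two unshifted ones.
      have h5 : ‖(qPoch (A * (B * p ^ N)) p m)⁻¹‖ ≤ C₄ * C₃ := by
        have h6 : (qPoch (A * (B * p ^ N)) p m)⁻¹ =
            qPoch (A * B) p N * (qPoch (A * B) p (N + m))⁻¹ := by
          have := qPoch_ne_zero h N
          have h7 := qPoch_ne_zero (hshift N) m
          rw [qPoch_add, ← mul_assoc A]
          rw [← mul_assoc A] at h7
          field_simp
        rw [h6, norm_mul]
        exact mul_le_mul (h₄ _) (h₃ _) (norm_nonneg _) hC₄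
      refine (norm_phiTerm_le hp _ hC₁ hC₂ (h₁ m) (h₂ m) h5).trans ?_
      have : ‖B * p ^ N‖ ≤ ‖B‖ := by
        rw [norm_mul, norm_pow]
        exact mul_le_of_le_one_right (norm_nonneg _) (pow_le_one₀ (norm_nonneg _) hp.le)
      gcongr)
  have hone : ∑' m, phiTerm p A 0 m = 1 := by
    rw [tsum_eq_single 0]
    · simp [phiTerm, qPoch]
    · intro m hm
      simp [phiTerm, hm]
  rw [hone] at hlim
  have e := tendsto_nhds_unique ((tendsto_qPoch (A * B) hp).mul_const (∑' m, phiTerm p A B m))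
    (((tendsto_qPoch B hp).mul hlim).congr fun N => (hiter N).symm)
  have hne := qPochInf_ne_zero hp h
  have : ∑' m, phiTerm p A B m = qPochInf B p / qPochInf (A * B) p := by
    rw [eq_div_iff hne]
    linear_combination e
  rw [← this]
  exact (summable_phiTerm hp hB h).hasSum

/-! ### Dissections of infinite products. -/

theorem tendsto_qPoch_mul (a : ℂ) {q : ℂ} (hq : ‖q‖ < 1) {k : ℕ} (hk : 0 < k) :
    Tendsto (fun n => qPoch a q (k * n)) atTop (𝓝 (qPochInf a q)) :=
  (tendsto_qPoch a hq).comp (tendsto_id.const_mul_atTop' hk)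

theorem norm_pow_lt_one {q : ℂ} (hq : ‖q‖ < 1) {k : ℕ} (hk : k ≠ 0) : ‖q ^ k‖ < 1 := by
  rw [norm_pow]; exact pow_lt_one₀ (norm_nonneg _) hq hk

theorem qPochInf_bisect (a : ℂ) {q : ℂ} (hq : ‖q‖ < 1) :
    qPochInf a q = qPochInf a (q ^ 2) * qPochInf (a * q) (q ^ 2) := by
  have hq2 := norm_pow_lt_one hq two_ne_zero
  refine tendsto_nhds_unique (tendsto_qPoch_mul a hq two_pos)
    (((tendsto_qPoch a hq2).mul (tendsto_qPoch (a * q) hq2)).congr fun n => ?_)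
  induction n with
  | zero => simp [qPoch_zero]
  | succ n ih =>
    rw [show 2 * (n + 1) = 2 * n + 1 + 1 by ring]
    simp only [qPoch_succ, ← ih]
    ring

theorem qPochInf_trisect (a : ℂ) {q : ℂ} (hq : ‖q‖ < 1) :
    qPochInf a q =
      qPochInf a (q ^ 3) * qPochInf (a * q) (q ^ 3) * qPochInf (a * q ^ 2) (q ^ 3) := by
  have hq3 := norm_pow_lt_one hq three_ne_zero
  refine tendsto_nhds_unique (tendsto_qPoch_mul a hq three_pos)
    ((((tendsto_qPoch a hq3).mul (tendsto_qPoch (a * q) hq3)).mul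
      (tendsto_qPoch (a * q ^ 2) hq3)).congr fun n => ?_)
  induction n with
  | zero => simp [qPoch_zero]
  | succ n ih =>
    rw [show 3 * (n + 1) = 3 * n + 1 + 1 + 1 by ring]
    simp only [qPoch_succ, ← ih]
    ring

theorem qPochInf_mul_neg (a : ℂ) {q : ℂ} (hq : ‖q‖ < 1) :
    qPochInf a q * qPochInf (-a) q = qPochInf (a ^ 2) (q ^ 2) := by
  refine tendsto_nhds_unique ((tendsto_qPoch a hq).mul (tendsto_qPoch (-a) hq))
    ((tendsto_qPoch (a ^ 2) (norm_pow_lt_one hq two_ne_zero)).congr fun n => ?_)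
  simp only [qPoch, ← Finset.prod_mul_distrib]
  refine Finset.prod_congr rfl fun k _ => ?_
  ring

/-! ### Interchange of summation and assembly. -/

/-- Summing a function on `ℕ × ℕ` along antidiagonals agrees with summing it by rows. -/
theorem hasSum_range_of_summable_prod {F : ℕ × ℕ → ℂ} (hF : Summable F) {g : ℕ → ℂ}
    (hg : ∀ r, HasSum (fun m => F (r, m)) (g r)) :
    HasSum (fun n => ∑ r ∈ Finset.range (n + 1), F (r, n - r)) (∑' r, g r) := by
  have h1 : ∑' x, F x = ∑' r, g r := (hF.hasSum.prod_fiberwise hg).tsum_eq.symm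
  have h2 : HasSum F (∑' r, g r) := h1 ▸ hF.hasSum
  rw [← Finset.HasAntidiagonal.sigmaAntidiagonalEquivProd.hasSum_iff] at h2
  have h3 := h2.sigma fun n => hasSum_fintype _
  convert h3 using 2 with n
  rw [← Finset.Nat.sum_antidiagonal_eq_sum_range_succ_mk, ← Finset.sum_coe_sort]
  rfl

theorem sq_eq_two_mul_choose_two_add (m : ℕ) : m ^ 2 = 2 * m.choose 2 + m := by
  induction m with
  | zero => simp
  | succ m ih =>
    rw [choose_succ_two]
    linarith

theorem hasSum_series {q : ℂ} (hq : ‖q‖ < 1) :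
    HasSum (fun n : ℕ => (-1) ^ n * qPoch q (q ^ 2) n * q ^ (n ^ 2 + 2 * n) /
        qPoch (q ^ 4) (q ^ 4) n)
      (qPochInf q (q ^ 2) / qPochInf (q ^ 2) (q ^ 2) *
        ∑' r : ℕ, ((q ^ 6) ^ (r.choose 2) * (q ^ 5) ^ r +
          (q ^ 6) ^ ((r + 1).choose 2) * q ^ (r + 1))) := by
  obtain ⟨p, hpq⟩ : ∃ p, p = q ^ 2 := ⟨_, rfl⟩
  have hp : ‖p‖ < 1 := hpq ▸ norm_pow_lt_one hq two_ne_zero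
  have hne := mul_pow_ne_one hp hp
  let c : ℕ → ℂ := fun n => (-1) ^ n * qPoch q p n * q ^ (n ^ 2 + 2 * n)
  let α : ℕ → ℂ := fun r => (-1) ^ r * p ^ (r ^ 2) * (1 - p ^ (2 * r + 1))
  let F : ℕ × ℕ → ℂ := fun x => c (x.1 + x.2) *
    (α x.1 / (qPoch p p x.2 * qPoch p p (x.1 + x.2 + x.1 + 1)))
  have hF : Summable F := by
    obtain ⟨C₁, hC₁, h₁⟩ := exists_norm_qPoch_le q hp
    obtain ⟨C₂, hC₂, h₂⟩ := exists_norm_qPoch_inv_le hp hne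
    have hgeo := summable_geometric_of_lt_one (norm_nonneg q) hq
    have hs := ((hgeo.mul_of_nonneg hgeo (fun _ => by positivity)
      (fun _ => by positivity)).mul_left (C₁ * (2 * (C₂ * C₂))))
    refine Summable.of_norm_bounded hs fun x => ?_
    obtain ⟨r, m⟩ := x
    have hα : ‖α r‖ ≤ 2 := by
      simp only [α, norm_mul, norm_pow, norm_neg, norm_one, one_pow, one_mul]
      have h3 : ‖p‖ ^ (r ^ 2) ≤ 1 := pow_le_one₀ (norm_nonneg _) hp.le
      have h4 : ‖1 - p ^ (2 * r + 1)‖ ≤ 2 := by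
        refine (norm_sub_le _ _).trans ?_
        rw [norm_one, norm_pow]
        have : ‖p‖ ^ (2 * r + 1) ≤ 1 := pow_le_one₀ (norm_nonneg _) hp.le
        linarith
      nlinarith [norm_nonneg (1 - p ^ (2 * r + 1))]
    have hc : ‖c (r + m)‖ ≤ C₁ * (‖q‖ ^ r * ‖q‖ ^ m) := by
      simp only [c, norm_mul, norm_pow, norm_neg, norm_one, one_pow, one_mul, ← pow_add]
      refine mul_le_mul (h₁ _) (pow_le_pow_of_le_one (norm_nonneg _) hq.le ?_)
        (by positivity) hC₁
      nlinarith
    simp only [F, div_eq_mul_inv, mul_inv, norm_mul]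
    calc _ ≤ C₁ * (‖q‖ ^ r * ‖q‖ ^ m) * (2 * (C₂ * C₂)) := by
          gcongr
          · exact h₂ _
          · exact h₂ _
      _ = _ := by ring
  have hrow : ∀ r, HasSum (fun m => F (r, m)) (qPochInf q p / qPochInf p p *
      ((q ^ 6) ^ (r.choose 2) * (q ^ 5) ^ r + (q ^ 6) ^ ((r + 1).choose 2) * q ^ (r + 1))) := by
    intro r
    have hB : ‖q * p ^ (r + 1)‖ < 1 := norm_mul_pow_lt_one hp hq _
    -- Since q² = p, the lower parameter AB is exactly what continues (p;p)_(2r+1) to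
    -- (p;p)_(2r+1+m).
    have hAB : q * p ^ r * (q * p ^ (r + 1)) = p * p ^ (2 * r + 1) := by rw [hpq]; ring
    have hABne : ∀ k, q * p ^ r * (q * p ^ (r + 1)) * p ^ k ≠ 1 := fun k => by
      rw [hAB, mul_assoc, ← pow_add]; exact hne _
    have h := (hasSum_phiTerm hp hB hABne).mul_left
      ((-1) ^ r * qPoch q p r * q ^ (r ^ 2 + 2 * r) * α r / qPoch p p (2 * r + 1))
    have hf : (fun m => F (r, m)) = fun m =>
        (-1) ^ r * qPoch q p r * q ^ (r ^ 2 + 2 * r) * α r / qPoch p p (2 * r + 1) *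
          phiTerm p (q * p ^ r) (q * p ^ (r + 1)) m := by
      funext m
      have e1 : r + m + r + 1 = 2 * r + 1 + m := by ring
      have e2 : q ^ ((r + m) ^ 2 + 2 * (r + m)) =
          q ^ (r ^ 2 + 2 * r) * p ^ (m.choose 2) * (q * p ^ (r + 1)) ^ m := by
        rw [hpq, ← pow_mul, ← pow_mul, ← pow_succ', ← pow_mul, ← pow_add, ← pow_add]
        congr 1
        have := sq_eq_two_mul_choose_two_add m
        linarith
      simp only [F, c, phiTerm, hAB, e1, e2, qPoch_add q p r m, qPoch_add p p (2 * r + 1) m,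
        pow_add (-1 : ℂ)]
      simp only [div_eq_mul_inv, mul_inv]
      ring
    -- Here 1 - p^(2r+1) = (1 - q^(2r+1))(1 + q^(2r+1)): the first factor extends (q;p)_r to
    -- (q;p)_(r+1), the second yields the two theta terms.
    have hα : (-1) ^ r * q ^ (r ^ 2 + 2 * r) * α r = (1 - q * p ^ r) *
        ((q ^ 6) ^ (r.choose 2) * (q ^ 5) ^ r + (q ^ 6) ^ ((r + 1).choose 2) * q ^ (r + 1)) := by
      have e5 : ((-1 : ℂ) ^ r) ^ 2 = 1 := by rw [← pow_mul, mul_comm, pow_mul]; simp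
      simp only [α, sq_eq_two_mul_choose_two_add, hpq, choose_succ_two]
      ring_nf
      simp only [mul_comm r 2, pow_mul (-1 : ℂ), neg_one_sq, one_pow]
      ring
    have hv : qPochInf q p / qPochInf p p *
        ((q ^ 6) ^ (r.choose 2) * (q ^ 5) ^ r + (q ^ 6) ^ ((r + 1).choose 2) * q ^ (r + 1)) =
        (-1) ^ r * qPoch q p r * q ^ (r ^ 2 + 2 * r) * α r / qPoch p p (2 * r + 1) *
          (qPochInf (q * p ^ (r + 1)) p / qPochInf (q * p ^ r * (q * p ^ (r + 1))) p) := by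
      rw [qPochInf_eq_mul q hp (r + 1), qPochInf_eq_mul p hp (2 * r + 1), hAB, qPoch_succ q p r]
      simp only [div_eq_mul_inv, mul_inv]
      linear_combination (-(qPoch q p r * qPochInf (q * p ^ (r + 1)) p *
        (qPoch p p (2 * r + 1))⁻¹ * (qPochInf (p * p ^ (2 * r + 1)) p)⁻¹)) * hα
    rw [hf, hv]
    exact h
  have hmain := hasSum_range_of_summable_prod hF hrow
  rw [tsum_mul_left, hpq] at hmain
  convert hmain using 2 with n
  have hb := sum_bailey_pair hp n
  have e4 : q ^ 4 = p ^ 2 := by rw [hpq]; ring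
  rw [div_eq_mul_inv, e4, ← hb, Finset.mul_sum]
  refine Finset.sum_congr rfl fun r hr => ?_
  simp only [F, c, α, Nat.add_sub_cancel' (Nat.lt_succ_iff.1 (Finset.mem_range.1 hr)), hpq]

theorem corollary2p3 (q : ℂ) (hq : ‖q‖ < 1) :
    -- the infinite products converge
    (Multipliable fun k : ℕ => 1 - q ^ 6 * (q ^ 6) ^ k) ∧
    (Multipliable fun k : ℕ => 1 - (-q ^ 3) * (q ^ 6) ^ k) ∧
    (Multipliable fun k : ℕ => 1 - q ^ 4 * (q ^ 4) ^ k) ∧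
    -- no denominator vanishes
    (∀ n : ℕ, qPoch (q ^ 4) (q ^ 4) n ≠ 0) ∧
    qPochInf (-q ^ 3) (q ^ 6) ≠ 0 ∧
    qPochInf (q ^ 4) (q ^ 4) ≠ 0 ∧
    -- the series converges absolutely, to the stated value
    HasSum
      (fun n : ℕ =>
        (-1) ^ n * qPoch q (q ^ 2) n * q ^ (n ^ 2 + 2 * n) / qPoch (q ^ 4) (q ^ 4) n)
      (qPochInf (q ^ 6) (q ^ 6) / (qPochInf (-q ^ 3) (q ^ 6) * qPochInf (q ^ 4) (q ^ 4))) := by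
  have h2 := norm_pow_lt_one hq (k := 2) (by norm_num)
  have h3 : ‖-q ^ 3‖ < 1 := by rw [norm_neg]; exact norm_pow_lt_one hq (by norm_num)
  have h4 := norm_pow_lt_one hq (k := 4) (by norm_num)
  have h5 := norm_pow_lt_one hq (k := 5) (by norm_num)
  have h6 := norm_pow_lt_one hq (k := 6) (by norm_num)
  have hn3 := qPochInf_ne_zero h6 (mul_pow_ne_one h3 h6)
  have hn4 := qPochInf_ne_zero h4 (mul_pow_ne_one h4 h4)
  refine ⟨multipliable_one_sub_mul_pow _ h6, multipliable_one_sub_mul_pow _ h6,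
    multipliable_one_sub_mul_pow _ h4, qPoch_ne_zero (mul_pow_ne_one h4 h4), hn3, hn4, ?_⟩
  convert hasSum_series hq using 1
  rw [tsum_jacobi h6 hq h5 (by ring)]
  have hn2 := qPochInf_ne_zero h2 (mul_pow_ne_one h2 h2)
  -- (-q;q²)_∞ contains the two Jacobi factors and (-q³;q⁶)_∞; times (q;q²)_∞ it is (q²;q⁴)_∞, which
  -- cancels from (q²;q²)_∞ and leaves (q⁴;q⁴)_∞.
  have t1 := qPochInf_trisect (-q) h2
  have t2 := qPochInf_mul_neg q h2
  have t3 := qPochInf_bisect (q ^ 2) h2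
  have e1 : -q * q ^ 2 = -q ^ 3 := by ring
  have e2 : -q * q ^ 4 = -q ^ 5 := by ring
  have e3 : q ^ 2 * q ^ 2 = q ^ 4 := by ring
  simp only [e1, e2, e3, ← pow_mul, Nat.reduceMul] at t1 t2 t3
  rw [← t2, t1] at t3
  field_simp
  rw [t3]
  ring
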